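/- **Setting.** Let $\mathcal M=(Q,A,\Gamma)$ be a robust Markov decision process: $Q$ and $A$ are finite, $A(q)\subseteq A$ is the nonempty set of actions available at $q\in Q$, and $\Gamma_{q,a}$ is a nonempty set of probability distributions on $Q$ for every $q\in Q$, $a\in A(q)$. Let $Q_{\rm tgt}\subseteq Q_{\rm safe}\subseteq Q$, and suppose that every state outside $Q_{\rm safe}$ is absorbing, i.e. $\Gamma_{q,a}=\{\delta_q\}$ for all $q\notin Q_{\rm safe}$, $a\in A(q)$. A strategy $\sigma\in\Sigma$ maps each finite path $q_0\xrightarrow{a_0}q_1\xrightarrow{a_1}\cdots\to q_k$ to an action in $A(q_k)$; it is stationary ($\sigma\in\Sigma_s$) if the action depends only on $q_k$, and is then written $\sigma(q_k)$. An adversary $\xi\in\Xi$ maps each finite path ending in $q$ and each $a\in A(q)$ to a distribution in $\Gamma_{q,a}$. Let $P_\xi^{q,\sigma}$ be the induced law of the state sequence $\omega(0)=q,\omega(1),\dots$, and put $$P_{\rm reach}(q,\sigma,\xi)=P_\xi^{q,\sigma}\big[\exists k\ge 0:\ \omega(k)\in Q_{\rm tgt}\ \text{and}\ \omega(j)\in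 Q_{\rm safe}\ \text{for all}\ j<k\big].$$ A strategy $\sigma^*\in\Sigma$ is *optimal* if for every $q\in Q$ it maximizes $\sigma\mapsto\inf_{\xi\in\Xi}P_{\rm reach}(q,\sigma,\xi)$ over $\Sigma$. Let $$\underline p^\infty(q)=\sup_{\sigma\in\Sigma}\inf_{\xi\in\Xi}P_{\rm reach}(q,\sigma,\xi),\qquad Q_{\rm reach}=\{q\in Q:\underline p^\infty(q)>0\},$$ $$A^*(q)=\arg\max_{a\in A(q)}\ \inf_{\gamma\in\Gamma_{q,a}}\ \sum_{q'\in Q}\gamma(q')\,\underline p^\infty(q').$$ **Proposition.** 1. Let $\sigma^*\in\Sigma_s$ satisfy, for every $q\in Q$, $\sigma^*(q)\in A^*(q)$ and $\lim_{k\to\infty}P_\xi^{q,\sigma^*}[\omega(k)\in Q_{\rm reach}]=0$ for all $\xi\in\Xi$. Then $\sigma^*$ is optimal. 2. More generally, let $\sigma^*\in\Sigma_s$ satisfy $\sigma^*(q)\in A^*(q)$ for every $q\in Q\setminus Q_{\rm tgt}$, and $\lim_{k\to\infty}P_\xi^{q,\sigma^*}[\omega(k)\in Q_{\rm reach}\text{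 and }\omega(j)\notin Q_{\rm tgt}\text{ for all }j<k]=0$ for all $q\in Q$ and $\xi\in\Xi$ (the same limit condition for the process that is moved to an absorbing state outside $Q_{\rm reach}$ one step after its first visit to $Q_{\rm tgt}$). Then $\sigma^*$ is optimal. 3. If $\sigma\in\Sigma_s$ is optimal, then $\sigma(q)\in A^*(q)$ for every $q\in Q\setminus Q_{\rm tgt}$. -/

import Mathlib

open MeasureTheory ProbabilityTheory Filter Topology

/-- Finite alternating sequences `q₀ →[a₀] q₁ →[a₁] ⋯ → q_k` of states and actions. -/
inductive FinPath (Q A : Type*) where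
  | init (q : Q) : FinPath Q A
  | step (p : FinPath Q A) (a : A) (q : Q) : FinPath Q A

/-- The last state of a finite path. -/
def FinPath.last {Q A : Type*} : FinPath Q A → Q
  | .init q => q
  | .step _ _ q => q

/-- A robust MDP: `act q` is the set of actions available at `q`, and `Γ q a` is the set of
possible transition distributions at `(q, a)`, an arbitrary nonempty set, chosen independently for
each state-action pair (rectangularity). -/
structure RobustMDP (Q A : Type*) where
  act : Q → Set A
  act_nonempty : ∀ q, (act q).Nonempty
  Γ : Q → A → Set (PMF Q)
  Γ_nonempty : ∀ q, ∀ a ∈ act q, (Γ q a).Nonempty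

namespace RobustMDP

variable {Q A : Type*}

/-- A (history-dependent, deterministic) strategy. It is a total function on alternating sequences;
the values on sequences that are not paths of the robust MDP have no effect. -/
structure Strategy (M : RobustMDP Q A) where
  toFun : FinPath Q A → A
  mem_act : ∀ p, toFun p ∈ M.act p.last

/-- A stationary strategy: the action depends on the last state only. -/
structure StationaryStrategy (M : RobustMDP Q A) where
  toFun : Q → A
  mem_act : ∀ q, toFun q ∈ M.act q

/-- A stationary strategy, seen as a strategy. -/
def StationaryStrategy.toStrategy {M : RobustMDP Q A} (σ : M.StationaryStrategy) : M.Strategy where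
  toFun p := σ.toFun p.last
  mem_act p := σ.mem_act p.last

/-- A (history-dependent) adversary: it picks an admissible transition distribution for each
finite path and each action available at its last state. -/
structure Adversary (M : RobustMDP Q A) where
  toFun : FinPath Q A → A → PMF Q
  mem_Γ : ∀ p, ∀ a ∈ M.act p.last, toFun p a ∈ M.Γ p.last a

theorem strategy_nonempty (M : RobustMDP Q A) : Nonempty M.Strategy :=
  ⟨⟨fun p => (M.act_nonempty p.last).some, fun p => (M.act_nonempty p.last).some_mem⟩⟩

theorem adversary_nonempty (M : RobustMDP Q A) : Nonempty M.Adversary := by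
  classical
  refine ⟨⟨fun p a => if h : a ∈ M.act p.last then (M.Γ_nonempty p.last a h).some
    else PMF.pure p.last, fun p a h => ?_⟩⟩
  rw [dif_pos h]
  exact (M.Γ_nonempty p.last a h).some_mem

/-- The finite path up to time `n` with states `w 0, …, w n` and the actions picked by `σ`. -/
def Strategy.history {M : RobustMDP Q A} (σ : M.Strategy) (w : ℕ → Q) : ℕ → FinPath Q A
  | 0 => .init (w 0)
  | n + 1 => .step (σ.history w n) (σ.toFun (σ.history w n)) (w (n + 1))

/-- The distribution of the state at time `n + 1`, given the states `x` at times `0, …, n`. -/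
noncomputable def nextState {M : RobustMDP Q A} (σ : M.Strategy) (ξ : M.Adversary) (n : ℕ)
    (x : (i : Finset.Iic n) → Q) : PMF Q :=
  let p := σ.history (fun i => x ⟨min i n, Finset.mem_Iic.2 (min_le_right i n)⟩) n
  ξ.toFun p (σ.toFun p)

section Measure

variable [Finite Q] [MeasurableSpace Q] [DiscreteMeasurableSpace Q]

/-- `nextState` as a Markov kernel. -/
noncomputable def stepKernel {M : RobustMDP Q A} (σ : M.Strategy) (ξ : M.Adversary) (n : ℕ) :
    Kernel ((i : Finset.Iic n) → Q) Q :=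
  Kernel.ofFunOfCountable fun x => (nextState σ ξ n x).toMeasure

instance {M : RobustMDP Q A} (σ : M.Strategy) (ξ : M.Adversary) (n : ℕ) :
    IsMarkovKernel (stepKernel σ ξ n) :=
  ⟨fun x => PMF.toMeasure.isProbabilityMeasure (nextState σ ξ n x)⟩

/-- The law `P_ξ^{q,σ}` of the state sequence `ω(0), ω(1), …` started at `q`, by the
Ionescu-Tulcea theorem. -/
noncomputable def pathMeasure {M : RobustMDP Q A} (q : Q) (σ : M.Strategy) (ξ : M.Adversary) :
    Measure (ℕ → Q) :=
  Kernel.traj (X := fun _ => Q) (stepKernel σ ξ) 0 (fun _ => q)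

/-- The infinite-horizon reach-avoid probability. -/
noncomputable def reachProb {M : RobustMDP Q A} (safe tgt : Set Q) (q : Q) (σ : M.Strategy)
    (ξ : M.Adversary) : ℝ :=
  (pathMeasure q σ ξ).real {ω | ∃ k : ℕ, ω k ∈ tgt ∧ ∀ j < k, ω j ∈ safe}

/-- The worst-case reach-avoid probability of a strategy. -/
noncomputable def worstReach {M : RobustMDP Q A} (safe tgt : Set Q) (σ : M.Strategy) (q : Q) : ℝ :=
  ⨅ ξ : M.Adversary, reachProb safe tgt q σ ξ

/-- A strategy is optimal if it maximizes the worst-case reach-avoid probability among all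
strategies, simultaneously for all initial states. -/
def IsOptimal {M : RobustMDP Q A} (safe tgt : Set Q) (σ : M.Strategy) : Prop :=
  ∀ q, ∀ σ' : M.Strategy, worstReach safe tgt σ' q ≤ worstReach safe tgt σ q

/-- The optimal worst-case reach-avoid probability `p̲^∞(q)`. -/
noncomputable def optReach (M : RobustMDP Q A) (safe tgt : Set Q) (q : Q) : ℝ :=
  ⨆ σ : M.Strategy, worstReach safe tgt σ q

/-- The states from which the optimal worst-case reach-avoid probability is positive. -/
def Qreach (M : RobustMDP Q A) (safe tgt : Set Q) : Set Q :=
  {q | 0 < M.optReach safe tgt q}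

end Measure

/-- The worst-case expectation of `V` after one step from `q` under the action `a`. The infimum is
a minimum whenever the latter exists, for example if `Γ q a` is closed. -/
noncomputable def worstExp [Fintype Q] (M : RobustMDP Q A) (V : Q → ℝ) (q : Q) (a : A) : ℝ :=
  ⨅ γ : M.Γ q a, ∑ q' : Q, (γ.1 q').toReal * V q'

/-- `A*(q)`: the available actions that maximize `worstExp` of `p̲^∞`. -/
def Astar [Fintype Q] [MeasurableSpace Q] [DiscreteMeasurableSpace Q] (M : RobustMDP Q A)
    (safe tgt : Set Q) (q : Q) : Set A :=
  {a | a ∈ M.act q ∧ ∀ b ∈ M.act q,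
    M.worstExp (M.optReach safe tgt) q b ≤ M.worstExp (M.optReach safe tgt) q a}

end RobustMDP

/-! Write V for `optReach`. On safe non-target states, the worst case of a strategy is at most the
one-step worst expectation of the worst case of what remains of it (`worstReach_le_worstExp`): by
rectangularity the adversary may fix any first distribution and then a near-optimal continuation for
each successor. Hence V(q) ≤ `worstExp` V q a for a in A*(q).

Sufficiency: iterating this k times along a stationary strategy in A* gives, against every
adversary, V(q) ≤ P_reach + P[ω(k) ∈ Q_reach, no target before k], because V ≤ 1 and V vanishes off
Q_reach (`optReach_le_reachProb_add`). The limit hypothesis removes the last term.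

Necessity: for optimal stationary σ the first inequality reads V(q) ≤ `worstExp` V q (σ q), while
playing b once and then σ shows `worstExp` V q b ≤ V(q).

Everything rests on the first-step decomposition `pathMeasure_eq_sum`, checked on cylinders. No
infimum needs to be attained. -/

/-! ### Cylinder probabilities of Ionescu-Tulcea measures. -/

section Trajectories

open scoped ENNReal

variable {X : ℕ → Type*} [∀ n, MeasurableSpace (X n)]

/-- A transition kernel extends a trajectory by one step according to the last kernel. -/
theorem partialTraj_succ_self_singleton [∀ n, DiscreteMeasurableSpace (X n)]
    (κ : (n : ℕ) → Kernel ((i : Finset.Iic n) → X i) (X (n + 1))) [∀ n, IsMarkovKernel (κ n)]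
    (n : ℕ) (y : (i : Finset.Iic n) → X i) (x : (n : ℕ) → X n) :
    Kernel.partialTraj κ n (n + 1) y {Preorder.frestrictLe (n + 1) x} =
      Set.indicator {Preorder.frestrictLe n x} (fun y => κ n y {x (n + 1)}) y := by
  have : IsMarkovKernel ((κ n).map (MeasurableEquiv.piSingleton n)) :=
    Kernel.IsMarkovKernel.map _ (MeasurableEquiv.piSingleton n).measurable
  have hpre : IicProdIoc (X := X) n (n + 1) ⁻¹' {Preorder.frestrictLe (n + 1) x} =
      {Preorder.frestrictLe n x} ×ˢ
        (MeasurableEquiv.piSingleton n '' {x (n + 1)}) := by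
    ext ⟨u, v⟩
    simp only [Set.mem_preimage, Set.mem_singleton_iff, Set.mem_prod, Set.image_singleton]
    constructor
    · intro h
      refine ⟨?_, ?_⟩
      · ext ⟨i, hi⟩
        have hi' := Finset.mem_Iic.1 hi
        have := congrFun h ⟨i, Finset.mem_Iic.2 (by omega)⟩
        simpa [IicProdIoc, hi'] using this
      · apply (MeasurableEquiv.piSingleton n).symm.injective
        have := congrFun h ⟨n + 1, Finset.mem_Iic.2 le_rfl⟩
        simpa [IicProdIoc, MeasurableEquiv.piSingleton] using this
    · rintro ⟨rfl, rfl⟩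
      ext ⟨i, hi⟩
      have hi' := Finset.mem_Iic.1 hi
      by_cases h : i ≤ n
      · simp [IicProdIoc, h]
      · obtain rfl : i = n + 1 := by omega
        simp [IicProdIoc, MeasurableEquiv.piSingleton]
  rw [Kernel.partialTraj_succ_self, Kernel.map_apply' _ (by fun_prop) _ (measurableSet_singleton _),
    hpre, Kernel.prod_apply, Measure.prod_prod, Kernel.id_apply,
    Kernel.map_apply' _ (MeasurableEquiv.measurable _) _
      ((MeasurableEquiv.measurableSet_image _).2 (measurableSet_singleton _)),
    (MeasurableEquiv.piSingleton n).injective.preimage_image,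
    Measure.dirac_apply' _ (measurableSet_singleton _)]
  by_cases h : y ∈ ({Preorder.frestrictLe n x} : Set _) <;> simp [h]

/-- Only one past is compatible with the cylinder, so the integral over pasts collapses to a
product. -/
theorem traj_cylinder_succ [∀ n, DiscreteMeasurableSpace (X n)]
    (κ : (n : ℕ) → Kernel ((i : Finset.Iic n) → X i) (X (n + 1))) [∀ n, IsMarkovKernel (κ n)]
    (n : ℕ) (x₀ : (i : Finset.Iic 0) → X i) (x : (n : ℕ) → X n) :
    (Kernel.traj κ 0 x₀).map (Preorder.frestrictLe (n + 1)) {Preorder.frestrictLe (n + 1) x} =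
      (Kernel.traj κ 0 x₀).map (Preorder.frestrictLe n) {Preorder.frestrictLe n x} *
        κ n (Preorder.frestrictLe n x) {x (n + 1)} := by
  rw [Kernel.traj_map_frestrictLe_apply, Kernel.traj_map_frestrictLe_apply,
    Kernel.partialTraj_succ_eq_comp (Nat.zero_le n),
    Kernel.comp_apply' _ _ _ (measurableSet_singleton _)]
  simp_rw [partialTraj_succ_self_singleton]
  have : (Set.indicator {Preorder.frestrictLe n x} fun y => κ n y {x (n + 1)}) =
      Set.indicator {Preorder.frestrictLe n x}
        fun _ => κ n (Preorder.frestrictLe n x) {x (n + 1)} := by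
    ext y
    by_cases h : y = Preorder.frestrictLe n x <;> simp [h]
  rw [this, lintegral_indicator_const (measurableSet_singleton _), mul_comm]

theorem traj_cylinder_zero [∀ n, DiscreteMeasurableSpace (X n)]
    (κ : (n : ℕ) → Kernel ((i : Finset.Iic n) → X i) (X (n + 1))) [∀ n, IsMarkovKernel (κ n)]
    (x₀ : (i : Finset.Iic 0) → X i) :
    (Kernel.traj κ 0 x₀).map (Preorder.frestrictLe 0) = Measure.dirac x₀ := by
  rw [Kernel.traj_map_frestrictLe_apply, Kernel.partialTraj_self, Kernel.id_apply]

/-- Finite measures on sequences in a countable discrete space are determined by the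
probabilities of cylinders. -/
theorem ext_of_frestrictLe_singleton {Q : Type*} [MeasurableSpace Q] [DiscreteMeasurableSpace Q]
    [Countable Q] {μ ν : Measure (ℕ → Q)} [IsFiniteMeasure μ]
    (h : ∀ (n : ℕ) (x : ℕ → Q),
      μ.map (Preorder.frestrictLe n) {Preorder.frestrictLe (π := fun _ => Q) n x} =
      ν.map (Preorder.frestrictLe n) {Preorder.frestrictLe (π := fun _ => Q) n x}) : μ = ν := by
  have hne : ∀ n, ν.map (Preorder.frestrictLe (π := fun _ => Q) n) =
      μ.map (Preorder.frestrictLe (π := fun _ => Q) n) := by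
    intro n
    refine Measure.ext_of_singleton fun y => ?_
    -- Any finite sequence is the restriction of an infinite one: freeze it after time `n`.
    have hy : y = Preorder.frestrictLe (π := fun _ => Q) n
        (fun i => y ⟨min i n, Finset.mem_Iic.2 (min_le_right i n)⟩) := by
      ext ⟨i, hi⟩
      simp [min_eq_left (Finset.mem_Iic.1 hi)]
    rw [hy, h]
  have hfam : IsProjectiveMeasureFamily (α := fun _ : ℕ => Q) fun I => μ.map I.restrict := by
    intro I J hJI
    rw [Measure.map_map (by fun_prop) (by fun_prop)]
    rfl
  have hfin : ∀ I : Finset ℕ, IsFiniteMeasure (μ.map (I.restrict (π := fun _ => Q))) :=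
    fun I => inferInstance
  refine IsProjectiveLimit.unique (P := fun I => μ.map I.restrict) (fun I => rfl) ?_
  exact (isProjectiveLimit_nat_iff hfam ν).2 hne

end Trajectories

/-! ### Surgery at the start of paths, strategies and adversaries. -/

namespace FinPath

variable {Q A : Type*}

/-- The path that starts with `q →[a]` and continues with `p`. -/
def cons (q : Q) (a : A) : FinPath Q A → FinPath Q A
  | .init q' => .step (.init q) a q'
  | .step p a' q' => .step (cons q a p) a' q'

/-- The first state of a finite path. -/
def first : FinPath Q A → Q
  | .init q => q
  | .step p _ _ => first p

/-- The path without its first transition; paths without transitions are left unchanged. -/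
def tail : FinPath Q A → FinPath Q A
  | .init q => .init q
  | .step (.init _) _ q => .init q
  | .step (.step p a q) a' q' => .step (tail (.step p a q)) a' q'

@[simp]
theorem last_cons (q : Q) (a : A) (p : FinPath Q A) : (cons q a p).last = p.last := by
  cases p <;> rfl

@[simp]
theorem last_tail (p : FinPath Q A) : p.tail.last = p.last := by
  rcases p with q | ⟨_ | _, _, _⟩ <;> rfl

@[simp]
theorem tail_cons (q : Q) (a : A) (p : FinPath Q A) : (cons q a p).tail = p := by
  induction p with
  | init q' => rfl
  | step p a' q' ih =>
    cases p with
    | init => rfl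
    | step p b r => exact congrArg (fun t => FinPath.step t a' q') ih

theorem cons_eq_step (q : Q) (a : A) (p : FinPath Q A) :
    ∃ p' a' q', cons q a p = .step p' a' q' := by
  cases p with
  | init q' => exact ⟨_, _, _, rfl⟩
  | step p a' q' => exact ⟨_, _, _, rfl⟩

end FinPath

namespace RobustMDP

variable {Q A : Type*} {M : RobustMDP Q A}

@[ext]
theorem Strategy.ext {σ σ' : M.Strategy} (h : ∀ p, σ.toFun p = σ'.toFun p) : σ = σ' := by
  cases σ; cases σ'; congr; exact funext h

/-- The strategy that remains after the first transition `q →[a]`. -/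
def Strategy.shift (σ : M.Strategy) (q : Q) (a : A) : M.Strategy where
  toFun p := σ.toFun (p.cons q a)
  mem_act p := by simpa using σ.mem_act (p.cons q a)

/-- The adversary that remains after the first transition `q →[a]`. -/
def Adversary.shift (ξ : M.Adversary) (q : Q) (a : A) : M.Adversary where
  toFun p := ξ.toFun (p.cons q a)
  mem_Γ p b hb := by simpa using ξ.mem_Γ (p.cons q a) b (by simpa using hb)

/-- This lets the induction on the horizon keep the same strategy after one step. -/
theorem StationaryStrategy.shift_toStrategy (σ : M.StationaryStrategy) (q : Q) (a : A) :
    σ.toStrategy.shift q a = σ.toStrategy := by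
  ext p
  simp [Strategy.shift, StationaryStrategy.toStrategy]

/-- The strategy that plays `b` at time zero when started at `q`, and follows `σ` from then on. -/
noncomputable def Strategy.prefixAction (σ : M.Strategy) (q : Q) (b : A) (hb : b ∈ M.act q) :
    M.Strategy where
  toFun
    | .init q' => open Classical in if q' = q then b else σ.toFun (.init q')
    | .step p a q' => σ.toFun (FinPath.step p a q').tail
  mem_act
    | .init q' => by
      dsimp only
      split_ifs with h
      · exact h ▸ hb
      · exact σ.mem_act _
    | .step p a q' => by simpa using σ.mem_act (FinPath.step p a q').tail

theorem Strategy.prefixAction_init (σ : M.Strategy) {q : Q} {b : A} (hb : b ∈ M.act q) :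
    (σ.prefixAction q b hb).toFun (.init q) = b := by
  simp [prefixAction]

theorem Strategy.shift_prefixAction (σ : M.Strategy) {q : Q} {b : A} (hb : b ∈ M.act q) (q' : Q)
    (a : A) : (σ.prefixAction q b hb).shift q' a = σ := by
  ext p
  obtain ⟨p', a', q'', h⟩ := p.cons_eq_step q' a
  have h' := congrArg FinPath.tail h
  rw [FinPath.tail_cons] at h'
  simp only [shift, h]
  rw [h']
  rfl

/-- The adversary that picks `γ` at time zero at `(q, a)`, and follows `ξ q'` after a first
transition to `q'`. -/
noncomputable def Adversary.glue (q : Q) (a : A) (γ : PMF Q) (hγ : γ ∈ M.Γ q a)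
    (ξ : Q → M.Adversary) : M.Adversary where
  toFun
    -- At time zero away from `(q, a)`, any admissible value would do.
    | .init q', b => open Classical in
        if q' = q ∧ b = a then γ else (ξ q').toFun (.init q') b
    -- The first state of the tail is the state at time one, which selects the continuation.
    | .step p c q', b =>
        (ξ (FinPath.step p c q').tail.first).toFun (FinPath.step p c q').tail b
  mem_Γ
    | .init q', b, hb => by
      dsimp only
      split_ifs with h
      · obtain ⟨rfl, rfl⟩ := h
        exact hγ
      · exact (ξ q').mem_Γ _ b hb
    | .step p c q', b, hb => by
      have := (ξ (FinPath.step p c q').tail.first).mem_Γ (FinPath.step p c q').tail b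
        (by simpa using hb)
      simpa using this

theorem Adversary.glue_init {q : Q} {a : A} {γ : PMF Q} (hγ : γ ∈ M.Γ q a)
    (ξ : Q → M.Adversary) : (Adversary.glue q a γ hγ ξ).toFun (.init q) a = γ := by
  simp [glue]

theorem Adversary.glue_shift {q : Q} {a : A} {γ : PMF Q} (hγ : γ ∈ M.Γ q a)
    (ξ : Q → M.Adversary) (q' : Q) (b : A) (p : FinPath Q A) :
    ((Adversary.glue q a γ hγ ξ).shift q' b).toFun p = (ξ p.first).toFun p := by
  obtain ⟨p', a', q'', h⟩ := p.cons_eq_step q' b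
  have h' := congrArg FinPath.tail h
  rw [FinPath.tail_cons] at h'
  simp only [shift, h]
  rw [h']
  rfl

theorem Strategy.first_history (σ : M.Strategy) (w : ℕ → Q) (n : ℕ) :
    (σ.history w n).first = w 0 := by
  induction n with
  | zero => rfl
  | succ n ih => exact ih

theorem Strategy.history_congr (σ : M.Strategy) {w w' : ℕ → Q} {n : ℕ}
    (h : ∀ i ≤ n, w i = w' i) : σ.history w n = σ.history w' n := by
  induction n with
  | zero => simp [history, h 0 le_rfl]
  | succ n ih =>
    simp only [history]
    rw [ih fun i hi => h i (hi.trans n.le_succ), h (n + 1) le_rfl]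

/-- Histories grow at their end, whereas the first-step decomposition peels off their beginning;
this translates between the two. -/
theorem Strategy.history_succ_eq_cons (σ : M.Strategy) (w : ℕ → Q) (n : ℕ) :
    σ.history w (n + 1) = FinPath.cons (w 0) (σ.toFun (.init (w 0)))
      ((σ.shift (w 0) (σ.toFun (.init (w 0)))).history (fun i => w (i + 1)) n) := by
  induction n with
  | zero => rfl
  | succ n ih =>
    rw [history, ih]
    rfl

/-- The probability of the transition at time `n` of the state sequence `w`. -/
noncomputable def stepProb (σ : M.Strategy) (ξ : M.Adversary) (w : ℕ → Q) (n : ℕ) : ENNReal :=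
  ξ.toFun (σ.history w n) (σ.toFun (σ.history w n)) (w (n + 1))

theorem stepProb_zero (σ : M.Strategy) (ξ : M.Adversary) (w : ℕ → Q) :
    stepProb σ ξ w 0 = ξ.toFun (.init (w 0)) (σ.toFun (.init (w 0))) (w 1) := rfl

theorem stepProb_succ (σ : M.Strategy) (ξ : M.Adversary) (w : ℕ → Q) (n : ℕ) :
    stepProb σ ξ w (n + 1) =
      stepProb (σ.shift (w 0) (σ.toFun (.init (w 0)))) (ξ.shift (w 0) (σ.toFun (.init (w 0))))
        (fun i => w (i + 1)) n := by
  unfold stepProb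
  rw [σ.history_succ_eq_cons]
  rfl

/-- The sequence that starts with `q` and continues with `w`. -/
def consSeq (q : Q) (w : ℕ → Q) : ℕ → Q
  | 0 => q
  | n + 1 => w n

theorem measurable_consSeq [MeasurableSpace Q] (q : Q) : Measurable (consSeq q) := by
  refine measurable_pi_lambda _ fun n => ?_
  cases n with
  | zero => exact measurable_const
  | succ n => exact measurable_pi_apply n

/-! ### Cylinder probabilities under a strategy and an adversary. -/

section Measure

variable [Finite Q] [MeasurableSpace Q] [DiscreteMeasurableSpace Q]

instance (q : Q) (σ : M.Strategy) (ξ : M.Adversary) : IsProbabilityMeasure (pathMeasure q σ ξ) := by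
  unfold pathMeasure
  infer_instance

theorem pathMeasure_cylinder (q : Q) (σ : M.Strategy) (ξ : M.Adversary) (n : ℕ) (w : ℕ → Q) :
    (pathMeasure q σ ξ).map (Preorder.frestrictLe n)
        {Preorder.frestrictLe (π := fun _ => Q) n w} =
      Set.indicator {q} (fun _ => ∏ i ∈ Finset.range n, stepProb σ ξ w i) (w 0) := by
  induction n with
  | zero =>
    unfold pathMeasure
    rw [traj_cylinder_zero, Measure.dirac_apply' _ (measurableSet_singleton _)]
    by_cases h : w 0 = q
    · have : (fun _ => q) = Preorder.frestrictLe (π := fun _ => Q) 0 w := by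
        ext ⟨i, hi⟩
        obtain rfl : i = 0 := by simpa using hi
        exact h.symm
      simp [h, this]
    · have : (fun _ => q) ≠ Preorder.frestrictLe (π := fun _ => Q) 0 w := fun h' =>
        h (congrFun h' ⟨0, by simp⟩).symm
      simp [h, this]
  | succ n ih =>
    have hstep : stepKernel σ ξ n (Preorder.frestrictLe (π := fun _ => Q) n w) {w (n + 1)} =
        stepProb σ ξ w n := by
      change (nextState σ ξ n _).toMeasure {w (n + 1)} = _
      rw [PMF.toMeasure_apply_singleton _ _ (measurableSet_singleton _)]
      have : σ.history (fun i => Preorder.frestrictLe (π := fun _ => Q) n w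
          ⟨min i n, Finset.mem_Iic.2 (min_le_right i n)⟩) n = σ.history w n :=
        σ.history_congr fun i hi => by simp [hi]
      simp only [nextState, stepProb, this]
    unfold pathMeasure at ih ⊢
    rw [traj_cylinder_succ, ih, hstep, Finset.prod_range_succ]
    by_cases h : w 0 = q <;> simp [h]

/-- Adversaries that agree on the paths starting at `q` induce the same law. -/
theorem pathMeasure_congr {q : Q} {σ : M.Strategy} {ξ ξ' : M.Adversary}
    (h : ∀ p, p.first = q → ξ.toFun p = ξ'.toFun p) :
    pathMeasure q σ ξ = pathMeasure q σ ξ' := by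
  refine ext_of_frestrictLe_singleton fun n w => ?_
  rw [pathMeasure_cylinder, pathMeasure_cylinder]
  by_cases hw : w 0 = q
  · simp only [stepProb]
    simp_rw [fun i => h (σ.history w i) ((σ.first_history w i).trans hw)]
  · simp [hw]

end Measure

end RobustMDP

theorem PMF.sum_toReal {α : Type*} [Fintype α] (p : PMF α) : ∑ a, (p a).toReal = 1 := by
  rw [← ENNReal.toReal_sum fun a _ => p.apply_ne_top a, ← tsum_fintype (L := .unconditional _),
    p.tsum_coe, ENNReal.toReal_one]

/-! ### Measurability, one-step worst expectations and first-step analysis. -/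

namespace RobustMDP

section Measurability

variable {Q : Type*} [MeasurableSpace Q] [DiscreteMeasurableSpace Q] (safe tgt : Set Q)

theorem measurableSet_reach :
    MeasurableSet {ω : ℕ → Q | ∃ k : ℕ, ω k ∈ tgt ∧ ∀ j < k, ω j ∈ safe} := by
  simp only [Set.ofPred_exists, Set.ofPred_and, Set.ofPred_forall]
  exact .iUnion fun k => .inter (measurable_pi_apply k (.of_discrete)) <|
    .iInter fun j => .iInter fun _ => measurable_pi_apply j .of_discrete

theorem measurableSet_mem_and_forall_notMem (R : Set Q) (k : ℕ) :
    MeasurableSet {ω : ℕ → Q | ω k ∈ R ∧ ∀ j < k, ω j ∉ tgt} := by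
  simp only [Set.ofPred_and, Set.ofPred_forall]
  exact .inter (measurable_pi_apply k (.of_discrete)) <|
    .iInter fun j => .iInter fun _ => (measurable_pi_apply j (.of_discrete (s := tgt))).compl

end Measurability

section WorstExp

variable {Q A : Type*} {M : RobustMDP Q A} [Fintype Q]

/-- Nonnegativity of `V` supplies the lower bound that a real infimum requires. -/
theorem worstExp_le {V : Q → ℝ} (hV : ∀ q, 0 ≤ V q) {q : Q} {a : A} {γ : PMF Q}
    (hγ : γ ∈ M.Γ q a) : M.worstExp V q a ≤ ∑ q', (γ q').toReal * V q' :=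
  ciInf_le (f := fun γ : M.Γ q a => ∑ q', (γ.1 q').toReal * V q')
    ⟨0, by
      rintro _ ⟨γ, rfl⟩
      exact Finset.sum_nonneg fun q' _ => mul_nonneg ENNReal.toReal_nonneg (hV q')⟩ ⟨γ, hγ⟩

theorem worstExp_mono {V W : Q → ℝ} (hV : ∀ q, 0 ≤ V q) (hVW : ∀ q, V q ≤ W q) {q : Q} {a : A}
    (ha : a ∈ M.act q) : M.worstExp V q a ≤ M.worstExp W q a := by
  have : Nonempty (M.Γ q a) := (M.Γ_nonempty q a ha).to_subtype
  refine le_ciInf fun γ => (worstExp_le hV γ.2).trans ?_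
  exact Finset.sum_le_sum fun q' _ =>
    mul_le_mul_of_nonneg_left (hVW q') ENNReal.toReal_nonneg

end WorstExp

section FirstStep

variable {Q A : Type*} {M : RobustMDP Q A} [Fintype Q] [MeasurableSpace Q]
  [DiscreteMeasurableSpace Q]

/-- First-step decomposition of the law of the state sequence. -/
theorem pathMeasure_eq_sum (q : Q) (σ : M.Strategy) (ξ : M.Adversary) :
    pathMeasure q σ ξ = ∑ q', ξ.toFun (.init q) (σ.toFun (.init q)) q' •
      (pathMeasure q' (σ.shift q (σ.toFun (.init q))) (ξ.shift q (σ.toFun (.init q)))).map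
        (consSeq q) := by
  refine ext_of_frestrictLe_singleton fun n w => ?_
  have hm : Measurable (consSeq q) := measurable_consSeq q
  rw [pathMeasure_cylinder, Measure.map_apply (by fun_prop) (measurableSet_singleton _)]
  simp only [Measure.coe_finsetSum, Finset.sum_apply, Measure.smul_apply, smul_eq_mul]
  have hms : MeasurableSet (Preorder.frestrictLe (π := fun _ => Q) n ⁻¹'
      {Preorder.frestrictLe (π := fun _ => Q) n w}) :=
    (Preorder.measurable_frestrictLe (X := fun _ => Q) n) (measurableSet_singleton _)
  simp_rw [Measure.map_apply hm hms]
  by_cases hw : w 0 = q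
  swap
  · have : consSeq q ⁻¹' (Preorder.frestrictLe n ⁻¹'
        {Preorder.frestrictLe (π := fun _ => Q) n w}) = ∅ := by
      ext u
      simp only [Set.mem_preimage, Set.mem_singleton_iff, Set.mem_empty_iff_false, iff_false]
      exact fun h => hw (congrFun h ⟨0, by simp⟩).symm
    simp [this, hw]
  subst hw
  cases n with
  | zero =>
    have : consSeq (w 0) ⁻¹' (Preorder.frestrictLe 0 ⁻¹'
        {Preorder.frestrictLe (π := fun _ => Q) 0 w}) = Set.univ := by
      ext u
      simp only [Set.mem_preimage, Set.mem_singleton_iff, Set.mem_univ, iff_true]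
      ext ⟨i, hi⟩
      obtain rfl : i = 0 := by simpa using hi
      rfl
    simp only [this, measure_univ, mul_one]
    rw [← tsum_fintype (L := .unconditional _), PMF.tsum_coe]
    simp
  | succ n =>
    have : consSeq (w 0) ⁻¹' (Preorder.frestrictLe (n + 1) ⁻¹'
        {Preorder.frestrictLe (π := fun _ => Q) (n + 1) w}) =
        Preorder.frestrictLe (π := fun _ => Q) n ⁻¹'
          {Preorder.frestrictLe (π := fun _ => Q) n (fun i => w (i + 1))} := by
      ext u
      simp only [Set.mem_preimage, Set.mem_singleton_iff]
      constructor
      · intro h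
        ext ⟨i, hi⟩
        exact congrFun h ⟨i + 1, by simpa using hi⟩
      · intro h
        ext ⟨i, hi⟩
        cases i with
        | zero => rfl
        | succ i => exact congrFun h ⟨i, by simpa using hi⟩
    simp_rw [this, ← Measure.map_apply (Preorder.measurable_frestrictLe (X := fun _ => Q) n)
      (measurableSet_singleton _), pathMeasure_cylinder]
    -- A continuation started at `q'` meets the shifted cylinder only if `q' = w 1`.
    rw [Finset.sum_eq_single (w 1) (fun q' _ hq' => by simp [hq'.symm]) (by simp)]
    simp [Finset.prod_range_succ', stepProb_succ, stepProb_zero, mul_comm]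

theorem pathMeasure_real_eq_sum (q : Q) (σ : M.Strategy) (ξ : M.Adversary) {S : Set (ℕ → Q)}
    (hS : MeasurableSet S) :
    (pathMeasure q σ ξ).real S = ∑ q', (ξ.toFun (.init q) (σ.toFun (.init q)) q').toReal *
      (pathMeasure q' (σ.shift q (σ.toFun (.init q))) (ξ.shift q (σ.toFun (.init q)))).real
        (consSeq q ⁻¹' S) := by
  rw [Measure.real, pathMeasure_eq_sum]
  simp only [Measure.coe_finsetSum, Finset.sum_apply, Measure.smul_apply, smul_eq_mul]
  rw [ENNReal.toReal_sum fun q' _ => ENNReal.mul_ne_top (PMF.apply_ne_top _ _)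
    (measure_ne_top _ _)]
  simp_rw [ENNReal.toReal_mul, Measure.map_apply (measurable_consSeq q) hS]
  rfl

variable {safe tgt : Set Q}

theorem reachProb_nonneg (q : Q) (σ : M.Strategy) (ξ : M.Adversary) :
    0 ≤ reachProb safe tgt q σ ξ := measureReal_nonneg

theorem reachProb_le_one (q : Q) (σ : M.Strategy) (ξ : M.Adversary) :
    reachProb safe tgt q σ ξ ≤ 1 := measureReal_le_one

/-- After the first-step decomposition, time zero is `q` by definition of `consSeq`, so no
almost-sure argument is needed. -/
theorem reachProb_of_mem {q : Q} (hq : q ∈ tgt) (σ : M.Strategy) (ξ : M.Adversary) :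
    reachProb safe tgt q σ ξ = 1 := by
  have : consSeq q ⁻¹' {ω : ℕ → Q | ∃ k : ℕ, ω k ∈ tgt ∧ ∀ j < k, ω j ∈ safe} = Set.univ :=
    Set.eq_univ_of_forall fun w => ⟨0, hq, by simp⟩
  rw [reachProb, pathMeasure_real_eq_sum _ _ _ (measurableSet_reach safe tgt), this]
  simp [PMF.sum_toReal]

theorem reachProb_of_notMem (htgt : tgt ⊆ safe) {q : Q} (hq : q ∉ safe) (σ : M.Strategy)
    (ξ : M.Adversary) : reachProb safe tgt q σ ξ = 0 := by
  have : consSeq q ⁻¹' {ω : ℕ → Q | ∃ k : ℕ, ω k ∈ tgt ∧ ∀ j < k, ω j ∈ safe} = ∅ := by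
    refine Set.eq_empty_of_forall_notMem ?_
    rintro w ⟨k, hk, hj⟩
    cases k with
    | zero => exact hq (htgt hk)
    | succ k => exact hq (hj 0 k.succ_pos)
  rw [reachProb, pathMeasure_real_eq_sum _ _ _ (measurableSet_reach safe tgt), this]
  simp

/-- Prepending a safe non-target state does not affect whether a sequence reaches the target safely.
-/
theorem reachProb_eq_sum {q : Q} (hs : q ∈ safe) (ht : q ∉ tgt) (σ : M.Strategy)
    (ξ : M.Adversary) :
    reachProb safe tgt q σ ξ = ∑ q', (ξ.toFun (.init q) (σ.toFun (.init q)) q').toReal *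
      reachProb safe tgt q' (σ.shift q (σ.toFun (.init q)))
        (ξ.shift q (σ.toFun (.init q))) := by
  have : consSeq q ⁻¹' {ω : ℕ → Q | ∃ k : ℕ, ω k ∈ tgt ∧ ∀ j < k, ω j ∈ safe} =
      {ω : ℕ → Q | ∃ k : ℕ, ω k ∈ tgt ∧ ∀ j < k, ω j ∈ safe} := by
    ext w
    constructor
    · rintro ⟨k, hk, hj⟩
      cases k with
      | zero => exact (ht hk).elim
      | succ k => exact ⟨k, hk, fun j h => hj (j + 1) (by omega)⟩
    · rintro ⟨k, hk, hj⟩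
      refine ⟨k + 1, hk, fun j h => ?_⟩
      cases j with
      | zero => exact hs
      | succ j => exact hj j (by omega)
  rw [reachProb, pathMeasure_real_eq_sum _ _ _ (measurableSet_reach safe tgt), this]
  rfl

theorem pathMeasure_real_notMem_succ {q : Q} (ht : q ∉ tgt) (R : Set Q) (k : ℕ) (σ : M.Strategy)
    (ξ : M.Adversary) :
    (pathMeasure q σ ξ).real {ω | ω (k + 1) ∈ R ∧ ∀ j < k + 1, ω j ∉ tgt} =
      ∑ q', (ξ.toFun (.init q) (σ.toFun (.init q)) q').toReal *
        (pathMeasure q' (σ.shift q (σ.toFun (.init q)))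
          (ξ.shift q (σ.toFun (.init q)))).real {ω | ω k ∈ R ∧ ∀ j < k, ω j ∉ tgt} := by
  have : consSeq q ⁻¹' {ω : ℕ → Q | ω (k + 1) ∈ R ∧ ∀ j < k + 1, ω j ∉ tgt} =
      {ω : ℕ → Q | ω k ∈ R ∧ ∀ j < k, ω j ∉ tgt} := by
    ext w
    refine and_congr_right fun _ => ⟨fun h j hj => h (j + 1) (by omega), fun h j hj => ?_⟩
    cases j with
    | zero => exact ht
    | succ j => exact h j (by omega)
  rw [pathMeasure_real_eq_sum _ _ _ (measurableSet_mem_and_forall_notMem tgt R (k + 1)), this]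

theorem pathMeasure_real_zero_of_mem {q : Q} {R : Set Q} (hq : q ∈ R) (σ : M.Strategy)
    (ξ : M.Adversary) :
    (pathMeasure q σ ξ).real {ω | ω 0 ∈ R ∧ ∀ j < 0, ω j ∉ tgt} = 1 := by
  have : consSeq q ⁻¹' {ω : ℕ → Q | ω 0 ∈ R ∧ ∀ j < 0, ω j ∉ tgt} = Set.univ :=
    Set.eq_univ_of_forall fun w => ⟨hq, by simp⟩
  rw [pathMeasure_real_eq_sum _ _ _ (measurableSet_mem_and_forall_notMem tgt R 0), this]
  simp [PMF.sum_toReal]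

end FirstStep

/-! ### Bellman inequalities and optimality. -/

section Bellman

variable {Q A : Type*} {M : RobustMDP Q A} [Fintype Q] [MeasurableSpace Q]
  [DiscreteMeasurableSpace Q] {safe tgt : Set Q}

theorem bddBelow_reachProb (σ : M.Strategy) (q : Q) :
    BddBelow (Set.range fun ξ : M.Adversary => reachProb safe tgt q σ ξ) :=
  ⟨0, by rintro _ ⟨ξ, rfl⟩; exact reachProb_nonneg q σ ξ⟩

theorem worstReach_le_reachProb (σ : M.Strategy) (q : Q) (ξ : M.Adversary) :
    worstReach safe tgt σ q ≤ reachProb safe tgt q σ ξ :=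
  ciInf_le (bddBelow_reachProb σ q) ξ

theorem worstReach_le_one (σ : M.Strategy) (q : Q) : worstReach safe tgt σ q ≤ 1 :=
  (worstReach_le_reachProb σ q M.adversary_nonempty.some).trans (reachProb_le_one _ _ _)

theorem worstReach_nonneg (σ : M.Strategy) (q : Q) : 0 ≤ worstReach safe tgt σ q :=
  have := M.adversary_nonempty
  le_ciInf fun ξ => reachProb_nonneg q σ ξ

theorem worstReach_le_optReach (σ : M.Strategy) (q : Q) :
    worstReach safe tgt σ q ≤ M.optReach safe tgt q :=
  le_ciSup (f := fun σ : M.Strategy => worstReach safe tgt σ q)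
    ⟨1, by rintro _ ⟨σ, rfl⟩; exact worstReach_le_one σ q⟩ σ

theorem optReach_le_one (q : Q) : M.optReach safe tgt q ≤ 1 :=
  have := M.strategy_nonempty
  ciSup_le fun σ => worstReach_le_one σ q

theorem optReach_nonneg (q : Q) : 0 ≤ M.optReach safe tgt q :=
  (worstReach_nonneg M.strategy_nonempty.some q).trans (worstReach_le_optReach _ q)

theorem optReach_of_notMem (htgt : tgt ⊆ safe) {q : Q} (hq : q ∉ safe) :
    M.optReach safe tgt q = 0 := by
  have := M.strategy_nonempty
  refine (ciSup_le fun σ => ?_).antisymm (optReach_nonneg q)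
  exact (worstReach_le_reachProb σ q M.adversary_nonempty.some).trans_eq
    (reachProb_of_notMem htgt hq _ _)

theorem IsOptimal.worstReach_eq {σ : M.Strategy} (hσ : IsOptimal safe tgt σ) (q : Q) :
    worstReach safe tgt σ q = M.optReach safe tgt q :=
  have := M.strategy_nonempty
  (worstReach_le_optReach σ q).antisymm (ciSup_le fun σ' => hσ q σ')

/-- After the first step the adversary can respond optimally to the remaining strategy. -/
theorem worstReach_le_worstExp {q : Q} (hs : q ∈ safe) (ht : q ∉ tgt) (σ : M.Strategy) :
    worstReach safe tgt σ q ≤ M.worstExp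
      (worstReach safe tgt (σ.shift q (σ.toFun (.init q)))) q (σ.toFun (.init q)) := by
  set a := σ.toFun (.init q) with ha
  have : Nonempty (M.Γ q a) := (M.Γ_nonempty q a (σ.mem_act (.init q))).to_subtype
  refine le_ciInf fun γ => le_of_forall_pos_le_add fun ε hε => ?_
  have := M.adversary_nonempty
  -- An ε-optimal reply for each successor; the errors average to ε because `γ` has mass one.
  have hex : ∀ q', ∃ ξ : M.Adversary,
      reachProb safe tgt q' (σ.shift q a) ξ < worstReach safe tgt (σ.shift q a) q' + ε :=
    fun q' => exists_lt_of_ciInf_lt (lt_add_of_pos_right _ hε)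
  choose ξ hξ using hex
  refine (worstReach_le_reachProb σ q (Adversary.glue q a γ.1 γ.2 ξ)).trans ?_
  rw [reachProb_eq_sum hs ht, ← ha, Adversary.glue_init]
  have hcongr : ∀ q', reachProb safe tgt q' (σ.shift q a)
      ((Adversary.glue q a γ.1 γ.2 ξ).shift q a) =
      reachProb safe tgt q' (σ.shift q a) (ξ q') := fun q' => by
    unfold reachProb
    rw [pathMeasure_congr fun p hp => (Adversary.glue_shift γ.2 ξ q a p).trans (by rw [hp])]
  calc ∑ q', (γ.1 q').toReal * reachProb safe tgt q' (σ.shift q a)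
        ((Adversary.glue q a γ.1 γ.2 ξ).shift q a)
      ≤ ∑ q', (γ.1 q').toReal * (worstReach safe tgt (σ.shift q a) q' + ε) :=
        Finset.sum_le_sum fun q' _ => mul_le_mul_of_nonneg_left
          ((hcongr q').trans_le (hξ q').le) ENNReal.toReal_nonneg
    _ = ∑ q', (γ.1 q').toReal * worstReach safe tgt (σ.shift q a) q' + ε := by
        simp_rw [mul_add, Finset.sum_add_distrib, ← Finset.sum_mul, PMF.sum_toReal, one_mul]

/-- Every adversary splits into an admissible first distribution and a remainder, which can do no
better than the infimum at each successor. -/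
theorem worstExp_shift_le_worstReach {q : Q} (hs : q ∈ safe) (ht : q ∉ tgt) (σ : M.Strategy) :
    M.worstExp (worstReach safe tgt (σ.shift q (σ.toFun (.init q)))) q (σ.toFun (.init q)) ≤
      worstReach safe tgt σ q := by
  have := M.adversary_nonempty
  refine le_ciInf fun ξ => ?_
  rw [reachProb_eq_sum hs ht]
  refine (worstExp_le (worstReach_nonneg _)
    (ξ.mem_Γ (.init q) _ (σ.mem_act (.init q)))).trans ?_
  exact Finset.sum_le_sum fun q' _ =>
    mul_le_mul_of_nonneg_left (worstReach_le_reachProb _ _ _) ENNReal.toReal_nonneg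

/-- Actions in `Astar` dominate the optimal worst-case reach-avoid probability. -/
theorem optReach_le_worstExp_of_mem_Astar {q : Q} (hs : q ∈ safe) (ht : q ∉ tgt) {a : A}
    (ha : a ∈ M.Astar safe tgt q) :
    M.optReach safe tgt q ≤ M.worstExp (M.optReach safe tgt) q a := by
  have := M.strategy_nonempty
  refine ciSup_le fun σ => (worstReach_le_worstExp hs ht σ).trans ?_
  exact (worstExp_mono (worstReach_nonneg _) (worstReach_le_optReach _)
    (σ.mem_act (.init q))).trans (ha.2 _ (σ.mem_act (.init q)))

/-- Under a stationary strategy with values in `Astar`, the optimal value is lost only on the event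
of staying in `Qreach` without hitting the target. -/
theorem optReach_le_reachProb_add (htgt : tgt ⊆ safe) {σ : M.StationaryStrategy}
    (hσ : ∀ q ∉ tgt, σ.toFun q ∈ M.Astar safe tgt q) (k : ℕ) (q : Q) (ξ : M.Adversary) :
    M.optReach safe tgt q ≤ reachProb safe tgt q σ.toStrategy ξ +
      (pathMeasure q σ.toStrategy ξ).real
        {ω | ω k ∈ M.Qreach safe tgt ∧ ∀ j < k, ω j ∉ tgt} := by
  induction k generalizing q ξ with
  | zero =>
    -- At horizon zero the event is certain on `Qreach`, where 1 bounds the value; elsewhere the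
    -- value is at most 0.
    by_cases hq : q ∈ M.Qreach safe tgt
    · rw [pathMeasure_real_zero_of_mem hq]
      exact (optReach_le_one q).trans (le_add_of_nonneg_left (reachProb_nonneg _ _ _))
    · exact (not_lt.1 hq).trans (add_nonneg (reachProb_nonneg _ _ _) measureReal_nonneg)
  | succ k ih =>
    by_cases ht : q ∈ tgt
    · rw [reachProb_of_mem ht]
      exact (optReach_le_one q).trans (le_add_of_nonneg_right measureReal_nonneg)
    by_cases hs : q ∈ safe
    swap
    · rw [optReach_of_notMem htgt hs]
      exact add_nonneg (reachProb_nonneg _ _ _) measureReal_nonneg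
    rw [reachProb_eq_sum hs ht, pathMeasure_real_notMem_succ ht, ← Finset.sum_add_distrib,
      σ.shift_toStrategy]
    refine (optReach_le_worstExp_of_mem_Astar hs ht (hσ q ht)).trans
      ((worstExp_le optReach_nonneg (ξ.mem_Γ (.init q) _ (σ.mem_act q))).trans ?_)
    refine Finset.sum_le_sum fun q' _ => ?_
    rw [← mul_add]
    exact mul_le_mul_of_nonneg_left (ih q' _) ENNReal.toReal_nonneg

theorem isOptimal_of_mem_Astar (htgt : tgt ⊆ safe) {σ : M.StationaryStrategy}
    (hσ : ∀ q ∉ tgt, σ.toFun q ∈ M.Astar safe tgt q)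
    (hlim : ∀ (q : Q) (ξ : M.Adversary),
      Tendsto (fun k : ℕ => (pathMeasure q σ.toStrategy ξ).real
        {ω | ω k ∈ M.Qreach safe tgt ∧ ∀ j < k, ω j ∉ tgt}) atTop (𝓝 0)) :
    IsOptimal safe tgt σ.toStrategy := by
  intro q σ'
  have := M.adversary_nonempty
  refine (worstReach_le_optReach σ' q).trans (le_ciInf fun ξ => ?_)
  have h := (hlim q ξ).const_add (reachProb safe tgt q σ.toStrategy ξ)
  rw [add_zero] at h
  exact ge_of_tendsto' h fun k => optReach_le_reachProb_add htgt hσ k q ξ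

theorem IsOptimal.mem_Astar
    (habs : ∀ q ∉ safe, ∀ a ∈ M.act q, M.Γ q a = {PMF.pure q}) {σ : M.StationaryStrategy}
    (hσ : IsOptimal safe tgt σ.toStrategy) {q : Q} (ht : q ∉ tgt) :
    σ.toFun q ∈ M.Astar safe tgt q := by
  refine ⟨σ.mem_act q, fun b hb => ?_⟩
  by_cases hs : q ∈ safe
  swap
  -- At an absorbing state all available actions have the same uncertainty set, hence all are
  -- maximizers.
  · unfold worstExp
    rw [habs q hs b hb, habs q hs _ (σ.mem_act q)]
  have hV : worstReach safe tgt σ.toStrategy = M.optReach safe tgt := funext hσ.worstReach_eq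
  have hup := worstReach_le_worstExp hs ht σ.toStrategy
  -- The one-step deviation to `b` is an admissible competitor whose continuation has value
  -- `optReach`.
  have hlow := worstExp_shift_le_worstReach hs ht (σ.toStrategy.prefixAction q b hb)
  rw [Strategy.shift_prefixAction, Strategy.prefixAction_init, hV] at hlow
  rw [σ.shift_toStrategy, hV] at hup
  exact (hlow.trans (worstReach_le_optReach _ q)).trans hup

end Bellman

end RobustMDP

theorem mainTheorem7 {Q A : Type*} [Fintype Q] [MeasurableSpace Q] [DiscreteMeasurableSpace Q]
    [Finite A] (M : RobustMDP Q A) (safe tgt : Set Q) (htgt : tgt ⊆ safe)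
    -- unsafe states are absorbing
    (habs : ∀ q ∉ safe, ∀ a ∈ M.act q, M.Γ q a = {PMF.pure q}) :
    -- sufficiency
    (∀ σ : M.StationaryStrategy,
      (∀ q, σ.toFun q ∈ M.Astar safe tgt q) →
      (∀ (q : Q) (ξ : M.Adversary),
        Tendsto (fun k : ℕ => (RobustMDP.pathMeasure q σ.toStrategy ξ).real
          {ω | ω k ∈ M.Qreach safe tgt}) atTop (𝓝 0)) →
      RobustMDP.IsOptimal safe tgt σ.toStrategy) ∧
    -- sufficiency when the process is stopped (leaves `Q_reach`) right after visiting the target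
    (∀ σ : M.StationaryStrategy,
      (∀ q ∉ tgt, σ.toFun q ∈ M.Astar safe tgt q) →
      (∀ (q : Q) (ξ : M.Adversary),
        Tendsto (fun k : ℕ => (RobustMDP.pathMeasure q σ.toStrategy ξ).real
          {ω | ω k ∈ M.Qreach safe tgt ∧ ∀ j < k, ω j ∉ tgt}) atTop (𝓝 0)) →
      RobustMDP.IsOptimal safe tgt σ.toStrategy) ∧
    -- necessity
    (∀ σ : M.StationaryStrategy, RobustMDP.IsOptimal safe tgt σ.toStrategy →
      ∀ q ∉ tgt, σ.toFun q ∈ M.Astar safe tgt q) := by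
  refine ⟨fun σ hσ hlim => ?_, fun σ => RobustMDP.isOptimal_of_mem_Astar htgt,
    fun σ hσ q hq => hσ.mem_Astar habs hq⟩
  refine RobustMDP.isOptimal_of_mem_Astar htgt (fun q _ => hσ q) fun q ξ => ?_
  -- Dropping the condition of avoiding the target only enlarges the event.
  exact squeeze_zero (fun _ => measureReal_nonneg)
    (fun k => measureReal_mono fun ω hω => hω.1) (hlim q ξ)
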